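/- Let $n\ge 0$ and let $\alpha=(\alpha_1,\dots,\alpha_\ell)$ be a composition of $n$ (positive integers with sum $n$). Its diagram has $\alpha_i$ left-justified cells in row $i$, rows numbered from the top; $(i,k)$ is the cell in row $i$ and column $k$. A standard reverse composition tableau (SRCT) of shape $\alpha$ is a bijective filling $\tau$ of the cells with $1,\dots,n$ such that entries decrease from left to right along each row, entries increase from top to bottom in the first column, and whenever $i<j$ and $(i,k),(j,k+1)$ are cells with $\tau(i,k)>\tau(j,k+1)$, then $(i,k+1)$ is a cell and $\tau(i,k+1)>\tau(j,k+1)$. The $0$-Hecke algebra $H_n(0)$ is the unital associative $\mathbb{C}$-algebra generated by $T_1,\dots,T_{n-1}$ with relations $T_i^2=T_i$, $T_iT_{i+1}T_i=T_{i+1}T_iT_{i+1}$, and $T_iT_j=T_jT_i$ for $|i-j|\ge 2$. Let $\mathbf{S}_\alpha$ be the $\mathbb{C}$-vector space with basis the SRCTs of shape $\alpha$, made into an $H_n(0)$-module as follows. For an SRCT $\tau$ and $1\le i\le n-1$, call $i$ a descent of $\tau$ if $i+1$ lies in a column weakly to the right of the column of $i$, and say that $i,i+1$ are attacking if they lie in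 the same column, or if $i+1$ lies in the column immediately to the right of that of $i$ and in a strictly lower row. Then $T_i\tau=\tau$ if $i$ is not a descent of $\tau$; $T_i\tau=0$ if $i$ is a descent and $i,i+1$ are attacking; and otherwise $T_i\tau$ is the SRCT obtained from $\tau$ by interchanging $i$ and $i+1$. The composition $\alpha$ is called simple if, whenever $1\le i<j\le \ell$ and $\alpha_i\ge\alpha_j\ge 2$, there is an integer $k$ with $i<k<j$ and $\alpha_k=\alpha_j-1$. **Theorem.** The $H_n(0)$-module $\mathbf{S}_\alpha$ is generated by a single SRCT (that is, $\mathbf{S}_\alpha=H_n(0)\,\tau$ for some SRCT $\tau$ of shape $\alpha$) if and only if $\alpha$ is simple. -/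

import Mathlib

/-! ### The 0-Hecke algebra -/

/-- Defining relations of the 0-Hecke algebra, on the free algebra with generators indexed
by `Fin (n - 1)`: the index `i` (with `0 ≤ i < n - 1`) stands for the generator `T_{i+1}`. -/
inductive ZeroHeckeRel (n : ℕ) : FreeAlgebra ℂ (Fin (n - 1)) → FreeAlgebra ℂ (Fin (n - 1)) → Prop
  | idem (i : Fin (n - 1)) :
      ZeroHeckeRel n (FreeAlgebra.ι ℂ i * FreeAlgebra.ι ℂ i) (FreeAlgebra.ι ℂ i)
  | braid (i j : Fin (n - 1)) (h : (j : ℕ) = i + 1) :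
      ZeroHeckeRel n (FreeAlgebra.ι ℂ i * FreeAlgebra.ι ℂ j * FreeAlgebra.ι ℂ i)
        (FreeAlgebra.ι ℂ j * FreeAlgebra.ι ℂ i * FreeAlgebra.ι ℂ j)
  | comm (i j : Fin (n - 1)) (h : (i : ℕ) + 2 ≤ j) :
      ZeroHeckeRel n (FreeAlgebra.ι ℂ i * FreeAlgebra.ι ℂ j)
        (FreeAlgebra.ι ℂ j * FreeAlgebra.ι ℂ i)

/-- The 0-Hecke algebra `H_n(0)` over `ℂ`, by generators and relations. -/
abbrev ZeroHecke (n : ℕ) : Type := RingQuot (ZeroHeckeRel n)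

/-- The generators of `H_n(0)`. -/
noncomputable def ZeroHecke.T {n : ℕ} (i : Fin (n - 1)) : ZeroHecke n :=
  RingQuot.mkAlgHom ℂ (ZeroHeckeRel n) (FreeAlgebra.ι ℂ i)

/-! ### Standard reverse composition tableaux -/

namespace Composition

variable {n : ℕ}

/-- The cells of the reverse composition diagram of `α`: row `i` (from the top) has `α_i` cells,
left-justified.  Rows and columns are numbered from `0`. -/
abbrev Cell (α : Composition n) : Type := (i : Fin α.length) × Fin (α.blocksFun i)

/-- A composition is simple if `α_i ≥ α_j ≥ 2` with `i < j` implies that `α_k = α_j - 1` for some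
`k` strictly between `i` and `j`. -/
def IsSimple (α : Composition n) : Prop :=
  ∀ i j : Fin α.length, i < j → α.blocksFun j ≤ α.blocksFun i → 2 ≤ α.blocksFun j →
    ∃ k : Fin α.length, i < k ∧ k < j ∧ α.blocksFun k + 1 = α.blocksFun j

/-- Conditions for a bijective filling of the cells of `α` to be a standard reverse composition
tableau.  The entries are `0, …, n - 1` in place of `1, …, n`. -/
structure IsSRCT (α : Composition n) (τ : α.Cell ≃ Fin n) : Prop where
  row_decreasing : ∀ (i : Fin α.length) (k l : Fin (α.blocksFun i)), k < l → τ ⟨i, l⟩ < τ ⟨i, k⟩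
  firstColumn_increasing : ∀ (i j : Fin α.length) (hi : 0 < α.blocksFun i)
    (hj : 0 < α.blocksFun j), i < j → τ ⟨i, ⟨0, hi⟩⟩ < τ ⟨j, ⟨0, hj⟩⟩
  triple : ∀ (i j : Fin α.length) (k : ℕ) (hi : k < α.blocksFun i) (hj : k + 1 < α.blocksFun j),
    i < j → τ ⟨j, ⟨k + 1, hj⟩⟩ < τ ⟨i, ⟨k, hi⟩⟩ →
      ∃ hi' : k + 1 < α.blocksFun i, τ ⟨j, ⟨k + 1, hj⟩⟩ < τ ⟨i, ⟨k + 1, hi'⟩⟩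

/-- `SRCT α`: the set of standard reverse composition tableaux of shape `α`. -/
def SRCT (α : Composition n) : Type := {τ : α.Cell ≃ Fin n // α.IsSRCT τ}

namespace SRCT

variable {α : Composition n}

/-- The smaller of the two consecutive entries on which the `i`-th generator acts. -/
def lo (i : Fin (n - 1)) : Fin n := ⟨i, by omega⟩

/-- The larger of the two consecutive entries on which the `i`-th generator acts. -/
def hi (i : Fin (n - 1)) : Fin n := ⟨i + 1, by omega⟩

/-- The row containing the entry `x`. -/
def row (τ : α.SRCT) (x : Fin n) : ℕ := (τ.1.symm x).1

/-- The column containing the entry `x`. -/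
def col (τ : α.SRCT) (x : Fin n) : ℕ := (τ.1.symm x).2

/-- `i` is a descent: the next entry appears weakly to the right. -/
def IsDescent (i : Fin (n - 1)) (τ : α.SRCT) : Prop := τ.col (lo i) ≤ τ.col (hi i)

/-- `i` and the next entry are attacking: they are in the same column, or in adjacent columns
with the larger one strictly southeast of the smaller one. -/
def IsAttacking (i : Fin (n - 1)) (τ : α.SRCT) : Prop :=
  τ.col (lo i) = τ.col (hi i) ∨
    (τ.col (hi i) = τ.col (lo i) + 1 ∧ τ.row (lo i) < τ.row (hi i))

/-- The filling obtained from `τ` by interchanging two consecutive entries. -/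
def swapFilling (i : Fin (n - 1)) (τ : α.SRCT) : α.Cell ≃ Fin n :=
  τ.1.trans (Equiv.swap (lo i) (hi i))

theorem swap_lt_swap (i : Fin (n - 1)) {x y : Fin n} (hxy : x < y)
    (h : ¬(x = lo i ∧ y = hi i)) :
    Equiv.swap (lo i) (hi i) x < Equiv.swap (lo i) (hi i) y := by
  simp only [Equiv.swap_apply_def]
  simp only [lo, hi, Fin.ext_iff, Fin.lt_def] at *
  split_ifs <;> simp_all <;> omega

theorem lt_of_swap_lt (i : Fin (n - 1)) {x y : Fin n}
    (hxy : Equiv.swap (lo i) (hi i) x < Equiv.swap (lo i) (hi i) y)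
    (h : ¬(x = hi i ∧ y = lo i)) : x < y := by
  have := swap_lt_swap i hxy (by
    rintro ⟨h1, h2⟩
    rw [Equiv.swap_apply_eq_iff, Equiv.swap_apply_left] at h1
    rw [Equiv.swap_apply_eq_iff, Equiv.swap_apply_right] at h2
    exact h ⟨h1, h2⟩)
  simpa using this

/-- Interchanging the two entries of a non-attacking descent gives a tableau again. -/
theorem isSRCT_swapFilling (i : Fin (n - 1)) (τ : α.SRCT) (hd : IsDescent i τ)
    (ha : ¬IsAttacking i τ) : α.IsSRCT (swapFilling i τ) := by
  have key : ∀ p q : α.Cell, τ.1 p = lo i → τ.1 q = hi i →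
      (p.2 : ℕ) < q.2 ∧ ((q.2 : ℕ) = p.2 + 1 → q.1 ≤ p.1) ∧ p.1 ≠ q.1 := by
    intro p q hp hq
    have hp' : τ.1.symm (lo i) = p := by rw [← hp]; simp
    have hq' : τ.1.symm (hi i) = q := by rw [← hq]; simp
    have cp : τ.col (lo i) = p.2 := by rw [col, hp']
    have cq : τ.col (hi i) = q.2 := by rw [col, hq']
    have rp : τ.row (lo i) = p.1 := by rw [row, hp']
    have rq : τ.row (hi i) = q.1 := by rw [row, hq']
    simp only [IsDescent, IsAttacking, cp, cq, rp, rq, not_or, not_and, not_lt] at hd ha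
    refine ⟨lt_of_le_of_ne hd ha.1, ha.2, ?_⟩
    obtain ⟨r, a⟩ := p
    obtain ⟨s, b⟩ := q
    rintro (rfl : r = s)
    have := τ.2.row_decreasing r a b (lt_of_le_of_ne hd fun h => ha.1 (congrArg Fin.val h))
    rw [hp, hq] at this
    simp [lo, hi, Fin.lt_def] at this
  refine ⟨?_, ?_, ?_⟩
  · intro r k l hkl
    refine swap_lt_swap i (τ.2.row_decreasing r k l hkl) ?_
    rintro ⟨h1, h2⟩
    exact (key _ _ h1 h2).2.2 rfl
  · intro r s hr hs hrs
    refine swap_lt_swap i (τ.2.firstColumn_increasing r s hr hs hrs) ?_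
    rintro ⟨h1, h2⟩
    exact absurd (key _ _ h1 h2).1 (lt_irrefl 0)
  · intro r s k hr hs hrs hlt
    have hlt' : τ.1 ⟨s, ⟨k + 1, hs⟩⟩ < τ.1 ⟨r, ⟨k, hr⟩⟩ := by
      refine lt_of_swap_lt i hlt ?_
      rintro ⟨h1, h2⟩
      exact absurd ((key _ _ h2 h1).2.1 rfl) (not_le.mpr hrs)
    obtain ⟨hr', h⟩ := τ.2.triple r s k hr hs hrs hlt'
    refine ⟨hr', swap_lt_swap i h ?_⟩
    rintro ⟨h1, h2⟩
    exact absurd (key _ _ h1 h2).1 (lt_irrefl (k + 1))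

/-- `s_i(τ)` for a non-attacking descent `i` of `τ`. -/
def swap (i : Fin (n - 1)) (τ : α.SRCT) (hd : IsDescent i τ) (ha : ¬IsAttacking i τ) : α.SRCT :=
  ⟨swapFilling i τ, isSRCT_swapFilling i τ hd ha⟩

open Classical in
/-- The value of the operator `π_i` on a tableau, in the `ℂ`-vector space with basis `SRCT α`. -/
noncomputable def piTableau (i : Fin (n - 1)) (τ : α.SRCT) : α.SRCT →₀ ℂ :=
  if hd : IsDescent i τ then
    if ha : IsAttacking i τ then 0 else Finsupp.single (swap i τ hd ha) 1
  else Finsupp.single τ 1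

/-- The linear operator `π_i` on the `ℂ`-vector space with basis `SRCT α`. -/
noncomputable def piOp (i : Fin (n - 1)) : Module.End ℂ (α.SRCT →₀ ℂ) :=
  Finsupp.linearCombination ℂ (piTableau i)

theorem piOp_single (i : Fin (n - 1)) (τ : α.SRCT) :
    piOp i (Finsupp.single τ 1) = piTableau i τ := by
  simp [piOp]

theorem piTableau_of_not (i : Fin (n - 1)) (τ : α.SRCT) (h : ¬IsDescent i τ) :
    piTableau i τ = Finsupp.single τ 1 := by
  simp [piTableau, h]

theorem piTableau_of_attacking (i : Fin (n - 1)) (τ : α.SRCT) (h : IsDescent i τ)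
    (h' : IsAttacking i τ) : piTableau i τ = 0 := by
  simp [piTableau, h, h']

theorem piTableau_of_swap (i : Fin (n - 1)) (τ : α.SRCT) (h : IsDescent i τ)
    (h' : ¬IsAttacking i τ) : piTableau i τ = Finsupp.single (swap i τ h h') 1 := by
  simp [piTableau, h, h']

theorem swap_val_symm (i : Fin (n - 1)) (τ : α.SRCT) (h : IsDescent i τ)
    (h' : ¬IsAttacking i τ) (x : Fin n) :
    (swap i τ h h').1.symm x = τ.1.symm (Equiv.swap (lo i) (hi i) x) := rfl

theorem row_swap (i : Fin (n - 1)) (τ : α.SRCT) (h : IsDescent i τ)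
    (h' : ¬IsAttacking i τ) (x : Fin n) :
    (swap i τ h h').row x = τ.row (Equiv.swap (lo i) (hi i) x) := rfl

theorem col_swap (i : Fin (n - 1)) (τ : α.SRCT) (h : IsDescent i τ)
    (h' : ¬IsAttacking i τ) (x : Fin n) :
    (swap i τ h h').col x = τ.col (Equiv.swap (lo i) (hi i) x) := rfl

theorem ext_symm {τ σ : α.SRCT} (h : ∀ x, τ.1.symm x = σ.1.symm x) : τ = σ :=
  Subtype.ext (Equiv.symm_bijective.injective (Equiv.ext h))

theorem piOp_idem (i : Fin (n - 1)) :
    (piOp i * piOp i : Module.End ℂ (α.SRCT →₀ ℂ)) = piOp i := by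
  refine Finsupp.lhom_ext' fun τ => LinearMap.ext_ring ?_
  simp only [LinearMap.comp_apply, Finsupp.lsingle_apply, Module.End.mul_apply, piOp_single]
  by_cases hd : IsDescent i τ
  · by_cases ha : IsAttacking i τ
    · simp [piTableau_of_attacking i τ hd ha]
    · rw [piTableau_of_swap i τ hd ha, piOp_single, piTableau_of_not]
      have hd' : τ.col (lo i) ≤ τ.col (hi i) := hd
      have ha' : τ.col (lo i) ≠ τ.col (hi i) := fun h => ha (Or.inl h)
      simp only [IsDescent, col_swap, Equiv.swap_apply_left, Equiv.swap_apply_right]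
      omega
  · rw [piTableau_of_not i τ hd, piOp_single, piTableau_of_not i τ hd]

theorem piOp_comm (i j : Fin (n - 1)) (h : (i : ℕ) + 2 ≤ j) :
    (piOp i * piOp j : Module.End ℂ (α.SRCT →₀ ℂ)) = piOp j * piOp i := by
  refine Finsupp.lhom_ext' fun τ => LinearMap.ext_ring ?_
  simp only [LinearMap.comp_apply, Finsupp.lsingle_apply, Module.End.mul_apply, piOp_single]
  have n1 : lo i ≠ lo j := by simp only [lo, ne_eq, Fin.ext_iff]; omega
  have n2 : lo i ≠ hi j := by simp only [lo, hi, ne_eq, Fin.ext_iff]; omega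
  have n3 : hi i ≠ lo j := by simp only [lo, hi, ne_eq, Fin.ext_iff]; omega
  have n4 : hi i ≠ hi j := by simp only [hi, ne_eq, Fin.ext_iff]; omega
  have e1 : ∀ (σ : α.SRCT) h h', IsDescent i (swap j σ h h') ↔ IsDescent i σ := fun σ h h' => by
    simp only [IsDescent, col_swap, Equiv.swap_apply_of_ne_of_ne n1 n2,
      Equiv.swap_apply_of_ne_of_ne n3 n4]
  have e2 : ∀ (σ : α.SRCT) h h', IsAttacking i (swap j σ h h') ↔ IsAttacking i σ :=
    fun σ h h' => by
      simp only [IsAttacking, col_swap, row_swap, Equiv.swap_apply_of_ne_of_ne n1 n2,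
        Equiv.swap_apply_of_ne_of_ne n3 n4]
  have e3 : ∀ (σ : α.SRCT) h h', IsDescent j (swap i σ h h') ↔ IsDescent j σ := fun σ h h' => by
    simp only [IsDescent, col_swap, Equiv.swap_apply_of_ne_of_ne n1.symm n3.symm,
      Equiv.swap_apply_of_ne_of_ne n2.symm n4.symm]
  have e4 : ∀ (σ : α.SRCT) h h', IsAttacking j (swap i σ h h') ↔ IsAttacking j σ :=
    fun σ h h' => by
      simp only [IsAttacking, col_swap, row_swap, Equiv.swap_apply_of_ne_of_ne n1.symm n3.symm,
        Equiv.swap_apply_of_ne_of_ne n2.symm n4.symm]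
  by_cases d1 : IsDescent i τ <;> by_cases a1 : IsAttacking i τ <;>
    by_cases d2 : IsDescent j τ <;> by_cases a2 : IsAttacking j τ <;>
    simp [piTableau, d1, a1, d2, a2, piOp_single, e1, e2, e3, e4]
  congr 1
  refine ext_symm fun x => ?_
  simp only [swap_val_symm]
  congr 1
  simp only [Equiv.swap_apply_def]
  split_ifs <;> simp_all

set_option maxHeartbeats 1000000 in
theorem piOp_braid (i j : Fin (n - 1)) (h : (j : ℕ) = i + 1) :
    (piOp i * piOp j * piOp i : Module.End ℂ (α.SRCT →₀ ℂ)) = piOp j * piOp i * piOp j := by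
  refine Finsupp.lhom_ext' fun τ => LinearMap.ext_ring ?_
  simp only [LinearMap.comp_apply, Finsupp.lsingle_apply, Module.End.mul_apply, piOp_single]
  obtain ⟨a, ha⟩ : ∃ a, a = lo i := ⟨_, rfl⟩
  obtain ⟨b, hb⟩ : ∃ b, b = hi i := ⟨_, rfl⟩
  obtain ⟨c, hc⟩ : ∃ c, c = hi j := ⟨_, rfl⟩
  have hb' : lo j = b := by rw [hb]; simp only [lo, hi, Fin.ext_iff]; omega
  have nab : a ≠ b := by rw [ha, hb]; simp only [lo, hi, ne_eq, Fin.ext_iff]; omega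
  have nac : a ≠ c := by rw [ha, hc]; simp only [lo, hi, ne_eq, Fin.ext_iff]; omega
  have nbc : b ≠ c := by rw [hb, hc]; simp only [hi, ne_eq, Fin.ext_iff]; omega
  have si : ∀ x, Equiv.swap (lo i) (hi i) x = Equiv.swap a b x := fun x => by rw [ha, hb]
  have sj : ∀ x, Equiv.swap (lo j) (hi j) x = Equiv.swap b c x := fun x => by rw [hb', hc]
  have p1 : ∀ σ : α.SRCT, IsDescent i σ ↔ σ.col a ≤ σ.col b := fun σ => by rw [ha, hb]; rfl
  have p2 : ∀ σ : α.SRCT, IsDescent j σ ↔ σ.col b ≤ σ.col c := fun σ => by rw [← hb', hc]; rfl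
  have q1 : ∀ σ : α.SRCT, IsAttacking i σ ↔ (σ.col a = σ.col b ∨
      (σ.col b = σ.col a + 1 ∧ σ.row a < σ.row b)) := fun σ => by rw [ha, hb]; rfl
  have q2 : ∀ σ : α.SRCT, IsAttacking j σ ↔ (σ.col b = σ.col c ∨
      (σ.col c = σ.col b + 1 ∧ σ.row b < σ.row c)) := fun σ => by rw [← hb', hc]; rfl
  have b1 := Equiv.swap_apply_of_ne_of_ne nac.symm nbc.symm
  have b2 := Equiv.swap_apply_of_ne_of_ne nab nac
  by_cases d1 : τ.col a ≤ τ.col b <;> by_cases d2 : τ.col b ≤ τ.col c <;>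
    by_cases d3 : τ.col a ≤ τ.col c <;>
    by_cases a1 : (τ.col a = τ.col b ∨ (τ.col b = τ.col a + 1 ∧ τ.row a < τ.row b)) <;>
    by_cases a2 : (τ.col b = τ.col c ∨ (τ.col c = τ.col b + 1 ∧ τ.row b < τ.row c)) <;>
    by_cases a3 : (τ.col a = τ.col c ∨ (τ.col c = τ.col a + 1 ∧ τ.row a < τ.row c)) <;>
    first
    | (exfalso; omega)
    | skip
  all_goals
    try simp [piTableau, piOp_single, p1, p2, q1, q2, col_swap, row_swap, si, sj, b1, b2,
      d1, d2, d3, a1, a2, a3]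
    try (intro h'; exfalso; omega)
  congr 1
  refine ext_symm fun x => ?_
  simp only [swap_val_symm, si, sj]
  congr 1
  simp only [Equiv.swap_apply_def]
  split_ifs <;> simp_all

/-- The action of `H_n(0)` on the `ℂ`-vector space with basis `SRCT α`: the generators act by
the operators `π_i`. -/
noncomputable def action (α : Composition n) :
    ZeroHecke n →ₐ[ℂ] Module.End ℂ (α.SRCT →₀ ℂ) :=
  RingQuot.liftAlgHom ℂ ⟨FreeAlgebra.lift ℂ piOp, by
    intro x y h
    induction h with
    | idem i => simpa using piOp_idem i
    | braid i j h => simpa using piOp_braid i j h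
    | comm i j h => simpa using piOp_comm i j h⟩

theorem action_T (i : Fin (n - 1)) : action α (ZeroHecke.T i) = piOp i := by
  simp [action, ZeroHecke.T]

end SRCT

/-- The `H_n(0)`-module `𝐒_α`: the `ℂ`-vector space with basis `SRCT α`, on which the generators
`T_i` act by the operators `π_i`. -/
def QSModule (α : Composition n) : Type := α.SRCT →₀ ℂ

namespace QSModule

variable {α : Composition n}

noncomputable instance : AddCommGroup α.QSModule :=
  inferInstanceAs (AddCommGroup (α.SRCT →₀ ℂ))

noncomputable instance : Module ℂ α.QSModule :=
  inferInstanceAs (Module ℂ (α.SRCT →₀ ℂ))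

noncomputable instance : Module (ZeroHecke n) α.QSModule :=
  Module.compHom (α.SRCT →₀ ℂ) (SRCT.action α).toRingHom

/-- A tableau, as a basis vector of `𝐒_α`. -/
noncomputable def ofSRCT (τ : α.SRCT) : α.QSModule := Finsupp.single τ (1 : ℂ)

instance : IsScalarTower ℂ (ZeroHecke n) α.QSModule where
  smul_assoc c x v := by
    change SRCT.action α (c • x) v = c • SRCT.action α x v
    rw [map_smul]
    rfl

theorem T_smul_ofSRCT (i : Fin (n - 1)) (τ : α.SRCT) :
    (ZeroHecke.T i : ZeroHecke n) • ofSRCT τ = SRCT.piTableau i τ := by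
  change SRCT.action α (ZeroHecke.T i) (Finsupp.single τ 1) = _
  rw [SRCT.action_T, SRCT.piOp_single]

end QSModule

/-- `𝐒_α` is tableau-cyclic: it is generated, as an `H_n(0)`-module, by a single tableau. -/
def IsTableauCyclic (α : Composition n) : Prop :=
  ∃ τ : α.SRCT, Submodule.span (ZeroHecke n) {QSModule.ofSRCT τ} = ⊤

end Composition

namespace Composition

variable {n : ℕ} {α : Composition n}

/-! The relative order of the entries within each column is invariant under the action: each `piOp
i` fixes a tableau, kills it, or interchanges consecutive entries lying in different columns. A
single tableau can therefore generate only tableaux with its own column order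
(`colEquiv_of_mem_span`).

Every shape has a tableau with all columns increasing, namely the row-by-row filling
(`exists_isSource_colIncreasing`). So being cyclic forces every tableau to have increasing columns,
and `exists_not_colIncreasing` builds a counterexample for each non-simple shape.

If the shape is simple, all columns of all tableaux increase (`colIncreasing_of_isSimple`), so there
is only one column order. A tableau that is not a source is the image of another under some
generator (`exists_swap_eq`), and a weight shows that stepping back in this way ends at a source. A
column order admits at most one source (`eq_of_isSource`), so that source generates everything. -/

theorem cell_ext {p q : α.Cell} (h₁ : p.1 = q.1) (h₂ : (p.2 : ℕ) = q.2) : p = q := by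
  obtain ⟨r, a⟩ := p
  obtain ⟨s, b⟩ := q
  obtain rfl : r = s := h₁
  obtain rfl : a = b := Fin.ext h₂
  rfl

/-- A bijective filling of the diagram that orders the cells by a rank function, and cells of the
same rank from right to left. -/
theorem exists_filling (α : Composition n) (ρ : α.Cell → ℕ)
    (hρ : ∀ p q : α.Cell, ρ p = ρ q → (p.2 : ℕ) = q.2 → p = q) :
    ∃ e : α.Cell ≃ Fin n, ∀ p q,
      e p < e q ↔ ρ p < ρ q ∨ (ρ p = ρ q ∧ (q.2 : ℕ) < p.2) := by
  obtain ⟨f, hf⟩ : ∃ f : α.Cell → ℕ ×ₗ ℕᵒᵈ,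
      f = fun p => toLex (ρ p, OrderDual.toDual (p.2 : ℕ)) := ⟨_, rfl⟩
  have hinj : Function.Injective f := by
    intro p q h
    rw [hf] at h
    have h' := Prod.mk.inj (toLex.injective h)
    exact hρ p q h'.1 (OrderDual.toDual.injective h'.2)
  classical
  have hcard : Fintype.card (Set.range f) = n := by
    rw [Fintype.card_congr (Equiv.ofInjective f hinj).symm, Fintype.card_congr α.blocksFinEquiv,
      Fintype.card_fin]
  refine ⟨(Equiv.ofInjective f hinj).trans
    (Fintype.orderIsoFinOfCardEq (Set.range f) hcard).symm.toEquiv, fun p q => ?_⟩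
  refine ((Fintype.orderIsoFinOfCardEq (Set.range f) hcard).symm.lt_iff_lt).trans ?_
  rw [← Subtype.coe_lt_coe, Equiv.ofInjective_apply, Equiv.ofInjective_apply, hf]
  exact Prod.Lex.toLex_lt_toLex

/-! ### Column orders and source tableaux -/

namespace SRCT

/-- Any two entries in a common column are in the same relative order in both tableaux. -/
def ColEquiv (τ σ : α.SRCT) : Prop :=
  ∀ p q : α.Cell, (p.2 : ℕ) = q.2 → (τ.1 p < τ.1 q ↔ σ.1 p < σ.1 q)

/-- The entries increase from top to bottom in every column. -/
def ColIncreasing (τ : α.SRCT) : Prop :=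
  ∀ p q : α.Cell, (p.2 : ℕ) = q.2 → p.1 < q.1 → τ.1 p < τ.1 q

theorem ColIncreasing.colEquiv {τ σ : α.SRCT} (hτ : τ.ColIncreasing) (hσ : σ.ColIncreasing) :
    τ.ColEquiv σ := by
  intro p q h
  rcases lt_trichotomy p.1 q.1 with h' | h' | h'
  · exact iff_of_true (hτ p q h h') (hσ p q h h')
  · rw [cell_ext h' h]
    simp
  · exact iff_of_false (hτ q p h.symm h').not_gt (hσ q p h.symm h').not_gt

/-- Consecutive entries lie weakly to the right of each other or are left neighbours. -/
def IsSource (τ : α.SRCT) : Prop :=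
  ∀ i : Fin (n - 1), τ.IsDescent i ∨
    (τ.row (hi i) = τ.row (lo i) ∧ τ.col (hi i) + 1 = τ.col (lo i))

theorem col_apply (τ : α.SRCT) (p : α.Cell) : τ.col (τ.1 p) = p.2 := by
  rw [col, Equiv.symm_apply_apply]

theorem row_apply (τ : α.SRCT) (p : α.Cell) : τ.row (τ.1 p) = p.1 := by
  rw [row, Equiv.symm_apply_apply]

/-! ### Invariance of the column order under the action -/

/-- Interchanging consecutive entries alters only their mutual comparison, and non-attacking ones
lie in different columns. -/
theorem colEquiv_swap (i : Fin (n - 1)) (τ : α.SRCT) (h : IsDescent i τ)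
    (h' : ¬IsAttacking i τ) : τ.ColEquiv (swap i τ h h') := by
  intro p q hpq
  change _ ↔ Equiv.swap (lo i) (hi i) (τ.1 p) < Equiv.swap (lo i) (hi i) (τ.1 q)
  have hne : τ.col (lo i) ≠ τ.col (hi i) := fun h => h' (Or.inl h)
  constructor
  · refine fun hlt => swap_lt_swap i hlt ?_
    rintro ⟨h1, h2⟩
    rw [← h1, ← h2, col_apply, col_apply] at hne
    exact hne hpq
  · refine fun hlt => lt_of_swap_lt i hlt ?_
    rintro ⟨h1, h2⟩
    rw [← h1, ← h2, col_apply, col_apply] at hne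
    exact hne hpq.symm

theorem ColEquiv.trans {τ σ υ : α.SRCT} (h : τ.ColEquiv σ) (h' : σ.ColEquiv υ) : τ.ColEquiv υ :=
  fun p q e => (h p q e).trans (h' p q e)

theorem piOp_mem_supported (τ : α.SRCT) (i : Fin (n - 1)) {v : α.SRCT →₀ ℂ}
    (hv : v ∈ Finsupp.supported ℂ ℂ {σ : α.SRCT | τ.ColEquiv σ}) :
    piOp i v ∈ Finsupp.supported ℂ ℂ {σ : α.SRCT | τ.ColEquiv σ} := by
  rw [piOp, Finsupp.linearCombination_apply]
  refine Submodule.sum_mem _ fun σ hσ => Submodule.smul_mem _ _ ?_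
  have hσ' : τ.ColEquiv σ := hv hσ
  by_cases hd : IsDescent i σ
  · by_cases ha : IsAttacking i σ
    · rw [piTableau_of_attacking i σ hd ha]
      exact Submodule.zero_mem _
    · rw [piTableau_of_swap i σ hd ha]
      exact Finsupp.single_mem_supported ℂ _ (hσ'.trans (colEquiv_swap i σ hd ha))
  · rw [piTableau_of_not i σ hd]
    exact Finsupp.single_mem_supported ℂ _ hσ'

theorem action_mem_of_piOp_mem (W : Submodule ℂ (α.SRCT →₀ ℂ))
    (hW : ∀ i, ∀ v ∈ W, piOp i v ∈ W) (x : ZeroHecke n) {v : α.SRCT →₀ ℂ} (hv : v ∈ W) :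
    action α x v ∈ W := by
  obtain ⟨y, rfl⟩ := RingQuot.mkAlgHom_surjective ℂ (ZeroHeckeRel n) x
  induction y using FreeAlgebra.induction generalizing v with
  | grade0 c =>
    rw [AlgHom.commutes, AlgHom.commutes, Module.algebraMap_end_apply]
    exact W.smul_mem c hv
  | grade1 i =>
    change action α (ZeroHecke.T i) v ∈ W
    rw [action_T]
    exact hW i v hv
  | mul a b ha hb =>
    rw [map_mul, map_mul]
    exact ha (hb hv)
  | add a b ha hb =>
    rw [map_add, map_add]
    exact W.add_mem (ha hv) (hb hv)

theorem colEquiv_of_mem_span {τ σ : α.SRCT}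
    (h : QSModule.ofSRCT σ ∈ Submodule.span (ZeroHecke n) {QSModule.ofSRCT τ}) :
    τ.ColEquiv σ := by
  obtain ⟨x, hx⟩ := Submodule.mem_span_singleton.mp h
  have hmem : action α x (Finsupp.single τ 1) ∈
      Finsupp.supported ℂ ℂ {σ : α.SRCT | τ.ColEquiv σ} :=
    action_mem_of_piOp_mem _ (fun i v => piOp_mem_supported τ i) x
      (Finsupp.single_mem_supported ℂ _ fun _ _ _ => Iff.rfl)
  have hx' : action α x (Finsupp.single τ 1) = Finsupp.single σ 1 := hx
  rw [hx', Finsupp.mem_supported] at hmem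
  exact hmem (by simp)

/-! ### Source tableaux -/

/-- The positions of the entries are determined one at a time, from the smallest up. Once the
entries below `x` agree, `key`, applied in both directions, forces the column of `x`; the common
column order then forces its cell. -/
theorem eq_of_isSource {τ σ : α.SRCT} (hτ : τ.IsSource) (hσ : σ.IsSource)
    (h : τ.ColEquiv σ) : τ = σ := by
  have key : ∀ {τ σ : α.SRCT}, σ.IsSource → τ.ColEquiv σ → ∀ x : Fin n,
      (∀ y < x, τ.1.symm y = σ.1.symm y) → ¬ τ.col x < σ.col x := by
    intro τ σ hσ h x ih hlt
    obtain ⟨c, hc⟩ : ∃ c, c = τ.1.symm x := ⟨_, rfl⟩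
    have hcx : τ.1 c = x := by simp [hc]
    have hcol : τ.col x = c.2 := by rw [← hcx, col_apply]
    have hxc : x < σ.1 c := by
      rcases lt_trichotomy (σ.1 c) x with h1 | h1 | h1
      · have := ih _ h1
        rw [Equiv.symm_apply_apply, Equiv.symm_apply_eq, hcx] at this
        exact absurd this h1.ne
      · rw [← h1, col_apply, h1] at hlt
        omega
      · exact h1
    classical
    -- Let `m` be the first entry after `x` that `σ` places weakly left of the column of `c`. Its
    -- predecessor lies strictly right of that column, so `m - 1` is not a descent, and the source
    -- condition makes `m` its left neighbour, in the column of `c`.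
    have hex : ∃ m : ℕ, ∃ hm : m < n, (x : ℕ) < m ∧ σ.col ⟨m, hm⟩ ≤ τ.col x :=
      ⟨σ.1 c, (σ.1 c).2, hxc, by rw [hcol, Fin.eta, col_apply]⟩
    obtain ⟨hm, hxm, hmc⟩ := Nat.find_spec hex
    have hmin := fun k (hk : k < Nat.find hex) => Nat.find_min hex hk
    obtain ⟨m, hm'⟩ : ∃ m, m = Nat.find hex := ⟨_, rfl⟩
    simp only [← hm'] at hm hxm hmc hmin
    have hprev : τ.col x < σ.col ⟨m - 1, by omega⟩ := by
      by_cases hxm1 : (x : ℕ) = m - 1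
      · have : (⟨m - 1, by omega⟩ : Fin n) = x := Fin.ext hxm1.symm
        rw [this]
        exact hlt
      · by_contra hcon
        exact hmin (m - 1) (by omega) ⟨by omega, by omega, not_lt.mp hcon⟩
    have hlo : (lo ⟨m - 1, by omega⟩ : Fin n) = ⟨m - 1, by omega⟩ := rfl
    have hhi : (hi ⟨m - 1, by omega⟩ : Fin n) = ⟨m, hm⟩ := Fin.ext (by simp only [hi]; omega)
    have hs := hσ ⟨m - 1, by omega⟩
    rw [IsDescent, hlo, hhi] at hs
    rcases hs with hs | ⟨hrow, hs⟩
    · omega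
    have hmcol : σ.col ⟨m, hm⟩ = τ.col x := by omega
    obtain ⟨d, hd⟩ : ∃ d, d = σ.1.symm ⟨m, hm⟩ := ⟨_, rfl⟩
    have hdm : σ.1 d = ⟨m, hm⟩ := by simp [hd]
    obtain ⟨e, he⟩ : ∃ e, e = σ.1.symm ⟨m - 1, by omega⟩ := ⟨_, rfl⟩
    have hem : σ.1 e = ⟨m - 1, by omega⟩ := by simp [he]
    rw [← hdm, col_apply] at hmcol
    rw [← hdm, ← hem, col_apply, col_apply] at hs
    rw [← hdm, ← hem, row_apply, row_apply] at hrow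
    -- If `m` sits in `c` itself, the right neighbour `e` has an entry below `x` in `τ`, hence the
    -- same entry in `σ`, where it is `m - 1 ≥ x`. Otherwise the column order puts `σ.1 c` strictly
    -- between `x` and `m`, against minimality.
    by_cases hdc : d = c
    · subst hdc
      have hτe : τ.1 e < x := by
        rw [← hcx]
        obtain ⟨r, k⟩ := d
        obtain ⟨s, l⟩ := e
        obtain rfl : r = s := Fin.ext hrow
        exact τ.2.row_decreasing r k l (by simp only [Fin.lt_def] at *; omega)
      have := ih _ hτe
      rw [Equiv.symm_apply_apply] at this
      have h2 : σ.1 e = τ.1 e := ((Equiv.symm_apply_eq _).mp this.symm).symm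
      rw [hem] at h2
      rw [← h2, Fin.lt_def] at hτe
      simp only at hτe
      omega
    · have hlt' : ¬ τ.1 d < τ.1 c := by
        rw [hcx]
        intro hlt
        have := ih _ hlt
        rw [Equiv.symm_apply_apply] at this
        have h2 : σ.1 d = τ.1 d := ((Equiv.symm_apply_eq _).mp this.symm).symm
        rw [← h2, hdm, Fin.lt_def] at hlt
        simp only at hlt
        omega
      have hcd : τ.1 c < τ.1 d :=
        lt_of_le_of_ne (not_lt.mp hlt') fun h => hdc (τ.1.injective h).symm
      rw [h c d (by omega), hdm, Fin.lt_def] at hcd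
      exact hmin (σ.1 c) hcd ⟨(σ.1 c).2, hxc, by rw [hcol, Fin.eta, col_apply]⟩
  refine ext_symm fun x => ?_
  induction x using WellFoundedLT.induction with
  | ind x ih =>
    have h1 := key hσ h x ih
    have h2 := key hτ (fun p q e => (h p q e).symm) x fun y hy => (ih y hy).symm
    have hcol : τ.col x = σ.col x := by omega
    obtain ⟨c, hc⟩ : ∃ c, c = τ.1.symm x := ⟨_, rfl⟩
    obtain ⟨d, hd⟩ : ∃ d, d = σ.1.symm x := ⟨_, rfl⟩
    have hcx : τ.1 c = x := by simp [hc]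
    have hdx : σ.1 d = x := by simp [hd]
    have hcd : (c.2 : ℕ) = d.2 := by rw [← col_apply τ, ← col_apply σ, hcx, hdx, hcol]
    rw [← hc, ← hd]
    by_contra hne
    have hsymm : ∀ y z, y < x → τ.1.symm y = z → σ.1 z = y := by
      rintro y z hy rfl
      rw [ih y hy, Equiv.apply_symm_apply]
    rcases lt_or_gt_of_ne (fun e => hne (σ.1.injective e) : σ.1 c ≠ σ.1 d) with h3 | h3
    · rw [hdx] at h3
      have := ih _ h3
      rw [Equiv.symm_apply_apply, Equiv.symm_apply_eq, hcx] at this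
      exact h3.ne this
    · replace h3 := (h d c hcd.symm).mpr h3
      rw [hcx] at h3
      have := hsymm _ d h3 (by simp)
      rw [hdx] at this
      exact h3.ne this.symm

/-- The filling obtained by interchanging a non-descent whose next entry is not its left
neighbour. -/
theorem exists_swap_eq {τ : α.SRCT} (i : Fin (n - 1)) (hd : ¬IsDescent i τ)
    (hn : ¬(τ.row (hi i) = τ.row (lo i) ∧ τ.col (hi i) + 1 = τ.col (lo i))) :
    ∃ (σ : α.SRCT) (h : IsDescent i σ) (h' : ¬IsAttacking i σ), swap i σ h h' = τ := by
  obtain ⟨p, hp⟩ : ∃ p, p = τ.1.symm (lo i) := ⟨_, rfl⟩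
  obtain ⟨q, hq⟩ : ∃ q, q = τ.1.symm (hi i) := ⟨_, rfl⟩
  have hp' : τ.1 p = lo i := by simp [hp]
  have hq' : τ.1 q = hi i := by simp [hq]
  have hlh : (lo i : Fin n) < hi i := by simp [lo, hi, Fin.lt_def]
  rw [IsDescent, ← hp', ← hq', col_apply, col_apply, not_le] at hd
  rw [← hp', ← hq', col_apply, col_apply, row_apply, row_apply] at hn
  -- Each forbidden position of `p` and `q` is excluded by exhibiting an entry strictly between two
  -- consecutive ones.
  have hbetween : ∀ y : Fin n, lo i < y → ¬ y < hi i := by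
    intro y h1 h2
    simp only [lo, hi, Fin.lt_def] at h1 h2
    omega
  have hrow : p.1 ≠ q.1 := by
    intro he
    refine hn ⟨congrArg Fin.val he.symm, ?_⟩
    by_contra hne
    obtain ⟨r, k⟩ := p
    obtain ⟨s, l⟩ := q
    obtain rfl : r = s := he
    simp only at hd hne
    have hl : (l : ℕ) + 1 < k := by omega
    refine hbetween (τ.1 ⟨r, ⟨l + 1, by omega⟩⟩) ?_ ?_
    · rw [← hp']
      exact τ.2.row_decreasing _ _ _ (by simpa [Fin.lt_def] using hl)
    · rw [← hq']
      exact τ.2.row_decreasing _ _ _ (by simp [Fin.lt_def])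
  -- This is what makes the swapped filling non-attacking at `i`: if `q` were above `p`, the triple
  -- condition would put the right neighbour of `q` strictly between.
  have hadj : (p.2 : ℕ) = q.2 + 1 → p.1 < q.1 := by
    intro hcol
    by_contra hlt
    have hqp : q.1 < p.1 := lt_of_le_of_ne (not_lt.mp hlt) hrow.symm
    obtain ⟨r, k⟩ := p
    obtain ⟨s, l, hl⟩ := q
    obtain ⟨k, hk⟩ := k
    simp only at hcol hqp
    subst hcol
    obtain ⟨h1, h2⟩ := τ.2.triple s r l hl hk hqp (by rw [hp', hq']; exact hlh)
    refine hbetween _ (hp' ▸ h2) ?_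
    rw [← hq']
    exact τ.2.row_decreasing _ _ _ (by simp [Fin.lt_def])
  have hpe : ∀ x, τ.1 x = lo i → x = p := fun x hx => τ.1.injective (hx.trans hp'.symm)
  have hqe : ∀ x, τ.1 x = hi i → x = q := fun x hx => τ.1.injective (hx.trans hq'.symm)
  have hσ : α.IsSRCT (swapFilling i τ) := by
    refine ⟨?_, ?_, ?_⟩
    · intro r k l hkl
      refine swap_lt_swap i (τ.2.row_decreasing r k l hkl) ?_
      rintro ⟨h1, h2⟩
      exact hrow ((hpe _ h1) ▸ (hqe _ h2) ▸ rfl)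
    · intro r s hr hs hrs
      refine swap_lt_swap i (τ.2.firstColumn_increasing r s hr hs hrs) ?_
      rintro ⟨h1, h2⟩
      rw [← hpe _ h1, ← hqe _ h2] at hd
      exact absurd hd (lt_irrefl 0)
    · intro r s k hr hs hrs hlt
      by_cases hex : τ.1 ⟨s, ⟨k + 1, hs⟩⟩ = hi i ∧ τ.1 ⟨r, ⟨k, hr⟩⟩ = lo i
      · rw [← hpe _ hex.2, ← hqe _ hex.1] at hd
        simp at hd
      have hlt' : τ.1 ⟨s, ⟨k + 1, hs⟩⟩ < τ.1 ⟨r, ⟨k, hr⟩⟩ := lt_of_swap_lt i hlt hex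
      obtain ⟨hr', h⟩ := τ.2.triple r s k hr hs hrs hlt'
      refine ⟨hr', swap_lt_swap i h ?_⟩
      rintro ⟨h1, h2⟩
      rw [← hpe _ h1, ← hqe _ h2] at hd
      exact absurd hd (lt_irrefl (k + 1))
  have hlo : (swapFilling i τ).symm (lo i) = q := by
    rw [Equiv.symm_apply_eq]; simp [swapFilling, hq']
  have hhi : (swapFilling i τ).symm (hi i) = p := by
    rw [Equiv.symm_apply_eq]; simp [swapFilling, hp']
  refine ⟨⟨swapFilling i τ, hσ⟩, ?_, ?_, ?_⟩
  · change (((swapFilling i τ).symm (lo i)).2 : ℕ) ≤ ((swapFilling i τ).symm (hi i)).2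
    rw [hlo, hhi]
    omega
  · change ¬((((swapFilling i τ).symm (lo i)).2 : ℕ) = ((swapFilling i τ).symm (hi i)).2 ∨
      ((((swapFilling i τ).symm (hi i)).2 : ℕ) = ((swapFilling i τ).symm (lo i)).2 + 1 ∧
        (((swapFilling i τ).symm (lo i)).1 : ℕ) < ((swapFilling i τ).symm (hi i)).1))
    rw [hlo, hhi]
    rintro (h | ⟨h, h'⟩)
    · omega
    · exact absurd (hadj h) (not_lt.mpr (Fin.le_def.mpr h'.le))
  · refine ext_symm fun x => ?_
    change τ.1.symm ((Equiv.swap (lo i) (hi i)).symm (Equiv.swap (lo i) (hi i) x)) = _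
    rw [Equiv.symm_apply_apply]

/-- A weighted sum of columns, which grows when a non-attacking descent is interchanged. -/
def weight (τ : α.SRCT) : ℕ := ∑ x : Fin n, (n - x) * τ.col x

theorem weight_lt_weight_swap (i : Fin (n - 1)) (τ : α.SRCT) (h : IsDescent i τ)
    (h' : ¬IsAttacking i τ) : τ.weight < (swap i τ h h').weight := by
  have hcol : τ.col (lo i) < τ.col (hi i) :=
    lt_of_le_of_ne h fun e => h' (Or.inl e)
  have hne : hi i ∈ (Finset.univ.erase (lo i) : Finset (Fin n)) := by
    simp [lo, hi, Fin.ext_iff]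
  simp only [weight, col_swap]
  rw [← Finset.add_sum_erase _ _ (Finset.mem_univ (lo i)), ← Finset.add_sum_erase _ _ hne,
    ← Finset.add_sum_erase _ _ (Finset.mem_univ (lo i)), ← Finset.add_sum_erase _ _ hne,
    Equiv.swap_apply_left, Equiv.swap_apply_right, ← add_assoc, ← add_assoc]
  have hrest : ∑ x ∈ (Finset.univ.erase (lo i)).erase (hi i),
        (n - (x : ℕ)) * τ.col (Equiv.swap (lo i) (hi i) x) =
      ∑ x ∈ (Finset.univ.erase (lo i)).erase (hi i), (n - (x : ℕ)) * τ.col x := by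
    refine Finset.sum_congr rfl fun x hx => ?_
    simp only [Finset.mem_erase] at hx
    rw [Equiv.swap_apply_of_ne_of_ne hx.2.1 hx.1]
  rw [hrest]
  refine Nat.add_lt_add_right ?_ _
  obtain ⟨d, hd⟩ : ∃ d, n - (hi i : Fin n).1 = d := ⟨_, rfl⟩
  have hd' : n - (lo i : Fin n).1 = d + 1 := by
    have := i.2
    simp only [lo, hi] at hd ⊢
    omega
  rw [hd, hd']
  nlinarith

/-- Strong induction on `weight`: a non-source is `T_i` applied to a tableau of smaller weight. -/
theorem ofSRCT_mem_span_of_isSource {τ : α.SRCT}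
    (hτ : ∀ σ : α.SRCT, σ.IsSource → σ = τ) (σ : α.SRCT) :
    QSModule.ofSRCT σ ∈ Submodule.span (ZeroHecke n) {QSModule.ofSRCT τ} := by
  induction hw : σ.weight using Nat.strong_induction_on generalizing σ with
  | _ w ih =>
    subst hw
    by_cases hs : σ.IsSource
    · rw [hτ σ hs]
      exact Submodule.mem_span_singleton_self _
    · simp only [IsSource, not_forall, not_or] at hs
      obtain ⟨i, hd, hn⟩ := hs
      obtain ⟨υ, h, h', rfl⟩ := exists_swap_eq i hd hn
      have hT : (ZeroHecke.T i : ZeroHecke n) • QSModule.ofSRCT υ =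
          QSModule.ofSRCT (swap i υ h h') := by
        rw [QSModule.T_smul_ofSRCT, piTableau_of_swap i υ h h']
        rfl
      rw [← hT]
      exact Submodule.smul_mem _ _ (ih _ (weight_lt_weight_swap i υ h h') υ rfl)

theorem span_eq_top_of_forall_mem {N : Submodule (ZeroHecke n) α.QSModule}
    (h : ∀ σ : α.SRCT, QSModule.ofSRCT σ ∈ N) : N = ⊤ := by
  refine eq_top_iff.mpr fun v _ => ?_
  refine Finsupp.induction_linear (motive := fun v : α.SRCT →₀ ℂ => (show α.QSModule from v) ∈ N)
    v N.zero_mem (fun f g hf hg => N.add_mem hf hg) fun σ c => ?_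
  have hc : (Finsupp.single σ c : α.SRCT →₀ ℂ) = c • Finsupp.single σ 1 := by simp
  rw [hc]
  exact N.smul_of_tower_mem c (h σ)

/-! ### The canonical tableau -/

theorem exists_isSource_colIncreasing (α : Composition n) :
    ∃ τ : α.SRCT, τ.IsSource ∧ τ.ColIncreasing := by
  obtain ⟨e, he⟩ := α.exists_filling (fun p => p.1) fun p q h1 h2 => cell_ext (Fin.ext h1) h2
  have hsr : α.IsSRCT e := by
    refine ⟨fun r k l hkl => (he _ _).mpr (Or.inr ⟨rfl, hkl⟩),
      fun r s hr hs hrs => (he _ _).mpr (Or.inl hrs), fun r s k hr hs hrs hlt => ?_⟩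
    exact absurd hlt ((he _ _).mpr (Or.inl hrs)).not_gt
  refine ⟨⟨e, hsr⟩, fun i => ?_, fun p q _ h => (he _ _).mpr (Or.inl h)⟩
  obtain ⟨p, hp⟩ : ∃ p, p = e.symm (lo i) := ⟨_, rfl⟩
  obtain ⟨q, hq⟩ : ∃ q, q = e.symm (hi i) := ⟨_, rfl⟩
  have hp' : e p = lo i := by simp [hp]
  have hq' : e q = hi i := by simp [hq]
  have hbetween : ∀ c, e p < e c → ¬ e c < e q := by
    intro c h1 h2
    rw [hp'] at h1
    rw [hq'] at h2
    simp only [lo, hi, Fin.lt_def] at h1 h2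
    omega
  have hpq : e p < e q := by rw [hp', hq']; simp [lo, hi, Fin.lt_def]
  change ((e.symm (lo i)).2 : ℕ) ≤ (e.symm (hi i)).2 ∨
    (((e.symm (hi i)).1 : ℕ) = (e.symm (lo i)).1 ∧ ((e.symm (hi i)).2 : ℕ) + 1 = (e.symm (lo i)).2)
  rw [← hp, ← hq]
  -- If `q` is strictly left of `p`, then `p` is not in the first column. A lower row for `q` would
  -- put the first entry of the row of `p` in between, and a gap in the same row would put the right
  -- neighbour of `q` there.
  by_cases hcol : (p.2 : ℕ) ≤ q.2
  · exact Or.inl hcol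
  right
  rcases (he p q).mp hpq with h | ⟨h, -⟩
  · have h0 : 0 < α.blocksFun p.1 := p.2.pos
    refine absurd ((he ⟨p.1, ⟨0, h0⟩⟩ q).mpr (Or.inl h)) (hbetween _ ?_)
    exact (he _ _).mpr (Or.inr ⟨rfl, by simp only; omega⟩)
  · refine ⟨h.symm, ?_⟩
    by_contra hne
    have hl : (q.2 : ℕ) + 1 < α.blocksFun p.1 := by omega
    refine hbetween ⟨p.1, ⟨q.2 + 1, hl⟩⟩ ((he _ _).mpr (Or.inr ⟨rfl, ?_⟩))
      ((he _ _).mpr (Or.inr ⟨h, ?_⟩))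
    · simp only
      omega
    · simp

/-! ### Tableaux of simple and of non-simple shape -/

/-- An inversion propagates to the right: the next entry of row `j` is smaller still, so the triple
condition applies. Inversions can thus be tested at the end of the lower row. -/
theorem le_blocksFun_and_lt_of_inversion (τ : α.SRCT) {i j : Fin α.length} (hij : i < j) (k : ℕ)
    (hi : k < α.blocksFun i) (hj : k < α.blocksFun j) (h : τ.1 ⟨j, ⟨k, hj⟩⟩ < τ.1 ⟨i, ⟨k, hi⟩⟩)
    (m : ℕ) (hm : m < α.blocksFun j) (hkm : k ≤ m) :
    ∃ hm' : m < α.blocksFun i, τ.1 ⟨j, ⟨m, hm⟩⟩ < τ.1 ⟨i, ⟨m, hm'⟩⟩ := by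
  induction m, hkm using Nat.le_induction with
  | base => exact ⟨hi, h⟩
  | succ m hkm ih =>
    obtain ⟨h1, h2⟩ := ih (by omega)
    refine τ.2.triple i j m h1 hm hij (lt_trans ?_ h2)
    exact τ.2.row_decreasing j _ _ (by simp [Fin.lt_def])

theorem colIncreasing_of_isSimple (hα : α.IsSimple) (τ : α.SRCT) : τ.ColIncreasing := by
  have key : ∀ (m : ℕ) (i j : Fin α.length), i < j → ∀ (hi : m < α.blocksFun i)
      (hj : α.blocksFun j = m + 1),
      ¬ τ.1 ⟨j, ⟨m, by omega⟩⟩ < τ.1 ⟨i, ⟨m, hi⟩⟩ := by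
    intro m
    induction m with
    | zero =>
      intro i j hij hi hj
      exact (τ.2.firstColumn_increasing i j hi (by omega) hij).not_gt
    | succ m ih =>
      intro i j hij hi hj h
      -- Row `k` ends one column before row `j`, so the triple condition for these rows forces the
      -- last entry of row `k` below that of row `j`. The inversion then passes to rows `i` and `k`,
      -- one column to the left.
      obtain ⟨k, hik, hkj, hk⟩ := hα i j hij (by omega) (by omega)
      have hk' : α.blocksFun k = m + 1 := by omega
      refine ih i k hik (by omega) hk' (lt_trans (lt_of_not_ge fun hle => ?_)
        (h.trans (τ.2.row_decreasing i ⟨m, by omega⟩ ⟨m + 1, hi⟩ (by simp [Fin.lt_def]))))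
      have hlt : τ.1 ⟨j, ⟨m + 1, by omega⟩⟩ < τ.1 ⟨k, ⟨m, by omega⟩⟩ :=
        lt_of_le_of_ne hle fun e => by
          have := congrArg (fun c : α.Cell => (c.2 : ℕ)) (τ.1.injective e)
          simp at this
      obtain ⟨h1, -⟩ := τ.2.triple k j m (by omega) (by omega) hkj hlt
      omega
  rintro ⟨i, k⟩ ⟨j, l, hl⟩ hkl hij
  simp only at hkl hij
  subst hkl
  by_contra hlt
  have hlt' : τ.1 ⟨j, ⟨k, hl⟩⟩ < τ.1 ⟨i, k⟩ :=
    lt_of_le_of_ne (not_lt.mp hlt) fun e => hij.ne (congrArg Sigma.fst (τ.1.injective e)).symm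
  obtain ⟨h1, h2⟩ := le_blocksFun_and_lt_of_inversion τ hij k k.2 hl hlt'
    (α.blocksFun j - 1) (by omega) (by omega)
  exact key _ i j hij h1 (by omega) h2

/-- Take the row-by-row filling, but insert the last cell of row `j` just before row `i`. The triple
condition could fail only at a row strictly between that reaches the last or the second-to-last
column of row `j`, and `hgap` leaves no such row. -/
theorem exists_not_colIncreasing (hα : ¬α.IsSimple) : ∃ τ : α.SRCT, ¬τ.ColIncreasing := by
  obtain ⟨i, j, hij, hle, h2, hgap⟩ : ∃ i j : Fin α.length, i < j ∧
      α.blocksFun j ≤ α.blocksFun i ∧ 2 ≤ α.blocksFun j ∧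
      ∀ k, i < k → k < j → α.blocksFun k + 2 ≤ α.blocksFun j := by
    simp only [IsSimple, not_forall] at hα
    obtain ⟨i, j, hij, hle, h2, hno⟩ := hα
    -- Replacing `i` by the last row before `j` of length at least `α_j` makes all rows between
    -- shorter than `α_j`; length `α_j - 1` is excluded by assumption.
    obtain ⟨m, ⟨him, hmj, hmle⟩, hmax⟩ := (Set.toFinite {m : Fin α.length |
      i ≤ m ∧ m < j ∧ α.blocksFun j ≤ α.blocksFun m}).exists_maximal ⟨i, le_rfl, hij, hle⟩
    refine ⟨m, j, hmj, hmle, h2, fun k hmk hkj => ?_⟩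
    have h3 : ¬ α.blocksFun j ≤ α.blocksFun k := fun h =>
      hmk.not_ge (hmax ⟨him.trans hmk.le, hkj, h⟩ hmk.le)
    have h4 : α.blocksFun k + 1 ≠ α.blocksFun j := fun h =>
      hno ⟨k, lt_of_le_of_lt him hmk, hkj, h⟩
    omega
  classical
  obtain ⟨c, hc⟩ : ∃ c : α.Cell, c = ⟨j, ⟨α.blocksFun j - 1, by omega⟩⟩ := ⟨_, rfl⟩
  have hc1 : c.1 = j := by rw [hc]
  have hc2 : (c.2 : ℕ) + 1 = α.blocksFun j := by rw [hc]; simp only; omega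
  -- Odd ranks for the rows leave the even rank `2 * i` free, just below row `i`.
  obtain ⟨ρ, hρ⟩ : ∃ ρ : α.Cell → ℕ,
      ρ = fun p => if p = c then 2 * (i : ℕ) else 2 * (p.1 : ℕ) + 1 := ⟨_, rfl⟩
  have hρc : ρ c = 2 * (i : ℕ) := by simp [hρ]
  have hρn : ∀ p, p ≠ c → ρ p = 2 * (p.1 : ℕ) + 1 := fun p hp => by simp [hρ, hp]
  obtain ⟨e, he⟩ := α.exists_filling ρ fun p q h1 h2 => by
    by_cases hp : p = c <;> by_cases hq : q = c
    · rw [hp, hq]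
    · rw [hp, hρc, hρn q hq] at h1
      omega
    · rw [hq, hρc, hρn p hp] at h1
      omega
    · rw [hρn p hp, hρn q hq] at h1
      exact cell_ext (Fin.ext (by omega)) h2
  have hne1 : ∀ p : α.Cell, p.1 ≠ j → p ≠ c := fun p hp h => hp (h ▸ hc1)
  have hne2 : ∀ p : α.Cell, (p.2 : ℕ) + 1 ≠ α.blocksFun j → p ≠ c := fun p hp h => hp (h ▸ hc2)
  have hlast : ∀ p : α.Cell, p.1 = i → e c < e p := fun p hp => by
    rw [he, hρc, hρn p (hne1 p (hp ▸ hij.ne))]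
    have := congrArg Fin.val hp
    omega
  have hsr : α.IsSRCT e := by
    refine ⟨fun r k l hkl => ?_, fun r s hr hs hrs => ?_, fun r s k hr hs hrs hlt => ?_⟩
    · have hk : (⟨r, k⟩ : α.Cell) ≠ c := by
        intro h
        obtain rfl : r = j := by rw [← hc1, ← h]
        have hk := hc2
        rw [← h] at hk
        simp only at hk
        have := l.2
        rw [Fin.lt_def] at hkl
        omega
      rw [he, hρn _ hk]
      by_cases hl : (⟨r, l⟩ : α.Cell) = c
      · have hr : r = j := by rw [← hc1, ← hl]
        rw [hl, hρc]
        left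
        have := congrArg Fin.val hr
        simp only [Fin.lt_def] at hij ⊢
        omega
      · rw [hρn _ hl]
        exact Or.inr ⟨rfl, hkl⟩
    · rw [he, hρn _ (hne2 _ (by simp only; omega)), hρn _ (hne2 _ (by simp only; omega))]
      simp only [Fin.lt_def] at hrs ⊢
      omega
    · by_cases hsc : (⟨s, ⟨k + 1, hs⟩⟩ : α.Cell) = c
      · have hsj : s = j := by rw [← hc1, ← hsc]
        have hk : k + 1 + 1 = α.blocksFun j := by rw [← hc2, ← hsc]
        rw [hsc, he, hρc, hρn _ (hne1 _ (hsj ▸ hrs.ne))] at hlt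
        have hir : i ≤ r := by
          rw [Fin.le_def]
          simp only at hlt
          omega
        rcases hir.eq_or_lt with rfl | hir
        · exact ⟨by omega, hsc ▸ hlast _ rfl⟩
        · have := hgap r hir (hsj ▸ hrs)
          omega
      · refine absurd hlt (not_lt.mpr ?_)
        by_cases hrc : (⟨r, ⟨k, hr⟩⟩ : α.Cell) = c
        · have hrj : r = j := by rw [← hc1, ← hrc]
          refine le_of_lt ?_
          rw [he, hrc, hρc, hρn _ hsc]
          have := hij.trans (hrj ▸ hrs)
          simp only [Fin.lt_def] at this ⊢
          omega
        · refine le_of_lt ?_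
          rw [he, hρn _ hrc, hρn _ hsc]
          simp only [Fin.lt_def] at hrs ⊢
          omega
  refine ⟨⟨e, hsr⟩, fun h => ?_⟩
  have hci : (c.2 : ℕ) < α.blocksFun i := by omega
  exact (h ⟨i, ⟨c.2, hci⟩⟩ c rfl (hc1 ▸ hij)).not_gt (hlast _ rfl)

end SRCT

end Composition

open Composition SRCT in
theorem theorem7p5 (n : ℕ) (α : Composition n) : α.IsTableauCyclic ↔ α.IsSimple := by
  obtain ⟨τ, hsource, hτ⟩ := exists_isSource_colIncreasing α
  constructor
  · rintro ⟨υ, hυ⟩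
    by_contra hα
    obtain ⟨σ, hσ⟩ := exists_not_colIncreasing hα
    have h1 : υ.ColEquiv τ := colEquiv_of_mem_span (hυ ▸ Submodule.mem_top)
    have h2 : υ.ColEquiv σ := colEquiv_of_mem_span (hυ ▸ Submodule.mem_top)
    exact hσ fun p q e h => (h2 p q e).mp ((h1 p q e).mpr (hτ p q e h))
  · intro hα
    exact ⟨τ, span_eq_top_of_forall_mem (ofSRCT_mem_span_of_isSource fun σ hσ =>
      eq_of_isSource hσ hsource ((colIncreasing_of_isSimple hα σ).colEquiv hτ))⟩
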